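/- Let $(\mathcal S,\mathcal A,P,c,\gamma)$ be a finite Markov decision process with transition kernel $P(\cdot\mid s,a)$ on $\mathcal S$, stage cost $c:\mathcal S\times\mathcal A\to\mathbb R$ and discount factor $\gamma\in(0,1)$. For a policy $\pi:\mathcal S\to\mathcal A$ let $v^\pi(s)=\mathbb E\big[\sum_{t\ge0}\gamma^t c(s_t,\pi(s_t))\mid s_0=s\big]$, where $s_{t+1}\sim P(\cdot\mid s_t,\pi(s_t))$, and $q^\pi(s,a)=c(s,a)+\gamma\sum_{s'}P(s'\mid s,a)v^\pi(s')$. A policy $\pi^\star$ is optimal if $v^{\pi^\star}\le v^{\pi}$ for every $\pi$, and the optimal Q-function is $q^\star=q^{\pi^\star}$. Put $$[\overline{\mathbf T}(q)](s,a)=c(s,a)+\gamma\sum_{s'}P(s'\mid s,a)\min_{a'}q(s',a').$$ In every iteration $k=0,1,\dots$ a next state $\hat s_k(s,a)\sim P(\cdot\mid s,a)$ is sampled for every pair $(s,a)$, the samples of different iterations being independent. Let $[\widehat{\mathbf T}_k(q)](s,a)=c(s,a)+\gamma\min_{a'}q(\hat s_k(s,a),a')$ and $\lambda_k=1/(k+1)$.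 Q-learning (QL), started at $q_0$, is $q^{\rm QL}_0=q_0$, $q^{\rm QL}_{k+1}=(1-\lambda_k)q^{\rm QL}_k+\lambda_k\widehat{\mathbf T}_k(q^{\rm QL}_k)$. Rank-one Q-learning (R1-QL), started at $q_0\in\mathbb R^{\mathcal S\times\mathcal A}$ and a probability vector $d_{-1}$ on $\mathcal S\times\mathcal A$, chooses for each $(s,a)$ any $\hat a_k(s,a)\in\arg\min_{a'}q_k(\hat s_k(s,a),a')$ and sets $$f_k(y)=\sum_{(s,a):\,(\hat s_k(s,a),\hat a_k(s,a))=y}d_{k-1}(s,a),\qquad \tilde d_k=(1-\lambda_k)d_{k-1}+\lambda_k f_k,\qquad d_k=\tilde d_k/\|\tilde d_k\|_1,$$ $$q_{k+1}=(1-\lambda_k)q_k+\lambda_k\widehat{\mathbf T}_k(q_k)+\frac{\gamma\lambda_k}{1-\gamma}\big\langle d_k,\widehat{\mathbf T}_k(q_k)-q_k\big\rangle\mathbf 1 .$$ Then the optimal Q-function $q^\star$ exists, $q^\star=\overline{\mathbf T}(q^\star)$, and R1-QL converges to it almost surely with at least the same rate as QL: (i) For all $q_0$ and $d_{-1}$,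 almost surely $q_k\to q^\star$; moreover, almost surely, for every positive sequence $(\rho_k)$ with $\sum_{l<k}\rho_l=O(k\rho_k)$ (for instance $\rho_k=(k+1)^{-r}$ with $r<1$), if the QL iterates started at the same $q_0$ and driven by the same samples satisfy $\|q^{\rm QL}_k-q^\star\|_\infty=O(\rho_k)$, then $\|q_k-q^\star\|_\infty=O(\rho_k)$. (ii) For all real $r,s$: if for every $q_0$ the QL iterates started at $q_0$ satisfy $\|q^{\rm QL}_k-q^\star\|_\infty=O(k^{-r}(\log k)^s)$ almost surely, then for all $q_0$ and $d_{-1}$ the R1-QL iterates satisfy $\|q_k-q^\star\|_\infty=O(k^{-r}(\log k)^s)$ almost surely. -/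

import Mathlib

open MeasureTheory ProbabilityTheory Filter Topology Asymptotics

noncomputable section

/-- A finite discounted Markov decision process with states `S`, actions `A`, transition kernel `P`,
stage cost `c` and discount factor `γ ∈ (0,1)`. -/
structure MDP (S A : Type*) where
  P : S → A → PMF S
  c : S × A → ℝ
  γ : ℝ
  γ_pos : 0 < γ
  γ_lt_one : γ < 1

namespace MDP

variable {S A : Type*}

section Optimality

variable [Fintype S] [MeasurableSpace S] [MeasurableSingletonClass S]

/-- The next-state kernel under the policy `π`, as a function of the state history up to time `t`. -/
def stepKernel (M : MDP S A) (π : S → A) (t : ℕ) :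
    Kernel ((i : Finset.Iic t) → (fun _ : ℕ => S) i) S :=
  (Kernel.ofFunOfCountable fun s : S => (M.P s (π s)).toMeasure).comap
    (fun h => h ⟨t, Finset.mem_Iic.2 le_rfl⟩) (measurable_pi_apply _)

instance (M : MDP S A) (π : S → A) (t : ℕ) : IsMarkovKernel (M.stepKernel π t) := by
  constructor
  intro h
  rw [stepKernel, Kernel.comap_apply]
  exact PMF.toMeasure.isProbabilityMeasure _

/-- The law of the state trajectory `(s₀, s₁, …)` of the Markov chain under `π` with `s₀ = s`. -/
def trajLaw (M : MDP S A) (π : S → A) (s : S) : Measure (ℕ → S) :=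
  Kernel.trajMeasure (X := fun _ => S) (Measure.dirac s) (M.stepKernel π)

/-- The value function of `π`: the expected discounted cost over an infinite trajectory. -/
def value (M : MDP S A) (π : S → A) (s : S) : ℝ :=
  ∫ w, ∑' t : ℕ, M.γ ^ t * M.c (w t, π (w t)) ∂(M.trajLaw π s)

/-- The action-value function (Q-function) of `π`. -/
def qValue (M : MDP S A) (π : S → A) : S × A → ℝ :=
  fun z => M.c z + M.γ * ∑ s', (M.P z.1 z.2 s').toReal * M.value π s'

/-- `π` is an optimal policy. -/
def IsOptimalPolicy (M : MDP S A) (π : S → A) : Prop :=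
  ∀ π' : S → A, ∀ s, M.value π s ≤ M.value π' s

/-- `q` is the optimal Q-function, i.e. the Q-function of an optimal policy. -/
def IsOptimalQ (M : MDP S A) (q : S × A → ℝ) : Prop :=
  ∃ π : S → A, M.IsOptimalPolicy π ∧ q = M.qValue π

end Optimality

section Algorithms

variable [Fintype A] [Nonempty A]

/-- `min_{a} q(s, a)`. -/
def minQ (q : S × A → ℝ) (s : S) : ℝ :=
  Finset.univ.inf' Finset.univ_nonempty fun a => q (s, a)

/-- The Bellman optimality operator for Q-functions. -/
def bellmanQ [Fintype S] (M : MDP S A) (q : S × A → ℝ) : S × A → ℝ :=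
  fun z => M.c z + M.γ * ∑ s', (M.P z.1 z.2 s').toReal * minQ q s'

/-- The empirical Bellman operator; `x z` is the sampled next state for the state-action pair `z`. -/
def empBellmanQ (M : MDP S A) (x : S × A → S) (q : S × A → ℝ) : S × A → ℝ :=
  fun z => M.c z + M.γ * minQ q (x z)

/-- The step sizes `λ_k = 1/(k+1)`. -/
def stepSize (k : ℕ) : ℝ := 1 / ((k : ℝ) + 1)

/-- The iterates of synchronous Q-learning driven by the samples `x k z`, started at `q₀`. -/
def qlIter (M : MDP S A) (x : ℕ → S × A → S) (q₀ : S × A → ℝ) : ℕ → S × A → ℝ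
  | 0 => q₀
  | k + 1 => fun z =>
      qlIter M x q₀ k z -
        stepSize k * (qlIter M x q₀ k z - M.empBellmanQ (x k) (qlIter M x q₀ k) z)

variable [Fintype S]

open Classical in
/-- The vector `f` accumulated in one iteration: the mass `d z` of each pair `z` is added to the
entry `(x z, a z)`. -/
def pushMass (x : S × A → S) (a : S × A → A) (d : S × A → ℝ) : S × A → ℝ :=
  fun y => ∑ z, if (x z, a z) = y then d z else 0

/-- Normalization of a vector by its 1-norm. -/
def normalizeL1 (d : S × A → ℝ) : S × A → ℝ := fun y => d y / ∑ z, |d z|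

/-- `(q, d, a)` is a run of synchronous rank-one Q-learning driven by the samples `x k z`, with
initialization `q₀`, `d₀`. The index of `d` is shifted by one: `d 0` is the initial vector and
`d (k+1)` is the estimate formed in iteration `k`. The action `a k z` is an arbitrary minimizer of
`q k (x k z, ·)`, so every rule for breaking ties is covered. -/
structure IsR1QLRun (M : MDP S A) (x : ℕ → S × A → S) (q₀ d₀ : S × A → ℝ)
    (q d : ℕ → S × A → ℝ) (a : ℕ → S × A → A) : Prop where
  q_zero : q 0 = q₀
  d_zero : d 0 = d₀
  greedy : ∀ k z b, q k (x k z, a k z) ≤ q k (x k z, b)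
  d_succ : ∀ k, d (k + 1) =
    normalizeL1 ((1 - stepSize k) • d k + stepSize k • pushMass (x k) (a k) (d k))
  q_succ : ∀ k z, q (k + 1) z =
    (1 - stepSize k) * q k z + stepSize k * M.empBellmanQ (x k) (q k) z +
      M.γ * stepSize k / (1 - M.γ) * ∑ y, d (k + 1) y * (M.empBellmanQ (x k) (q k) y - q k y)

end Algorithms

/-- Samples from the generative model: in every iteration `k` and for every pair `z`, the random
state `X k z` has law `P(· | z)`, and the samples of different iterations are independent (samples
within one iteration may have any joint law). -/
structure IsSampling (M : MDP S A) [MeasurableSpace S] {Ω : Type*} [MeasurableSpace Ω]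
    (μ : Measure Ω) (X : ℕ → S × A → Ω → S) : Prop where
  measurable : ∀ k z, Measurable (X k z)
  law : ∀ k z, μ.map (X k z) = (M.P z.1 z.2).toMeasure
  indep : iIndepFun (fun k ω z => X k z ω) μ

end MDP

end

/-! The whole comparison of the two algorithms is pathwise. Minimization commutes with adding
constants and the weights `d` sum to one, so R1-QL equals QL on the same samples plus a constant
vector. The factor γ/(1-γ) makes the feedback of that constant cancel, leaving a running average of
the residuals of QL weighted by `d` (`eq_qlIter_add`).

Up to twice the QL error ε, each residual is the sampling noise at q⋆. With step sizes 1/(k+1), QL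
is itself a running average of its updates, so the partial sums of this noise are bounded by QL
errors. The weights move by at most 1/(k+1), so summation by parts passes this bound on to the
weighted noise, however `d` depends on the samples. Hence the R1-QL error is at most a constant
times ε and nested averages of ε (`norm_sub_le`), which preserve convergence to zero and every rate
ρ with ∑ρ = O(kρ).

Convergence of QL uses probability only through the law of large numbers for the next-state
frequencies; summation by parts and contraction do the rest. For (ii), two QL runs whose
initializations differ by a constant stay at least of order k^(-(1-γ)) apart. A rate valid for all
initializations thus has r < 1, and then it satisfies the summation condition. -/

lemma PMF.sum_toReal_eq_one {S : Type*} [Fintype S] (p : PMF S) : ∑ s, (p s).toReal = 1 := by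
  rw [← ENNReal.toReal_sum fun s _ => p.apply_ne_top s, ← tsum_fintype (L := .unconditional S),
    p.tsum_coe, ENNReal.toReal_one]

lemma PMF.sum_toReal_mul_le {S : Type*} [Fintype S] (p : PMF S) {f : S → ℝ} {b : ℝ}
    (h : ∀ s, f s ≤ b) : ∑ s, (p s).toReal * f s ≤ b := by
  calc ∑ s, (p s).toReal * f s ≤ ∑ s, (p s).toReal * b :=
        Finset.sum_le_sum fun s _ => mul_le_mul_of_nonneg_left (h s) ENNReal.toReal_nonneg
    _ = b := by rw [← Finset.sum_mul, p.sum_toReal_eq_one, one_mul]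

lemma PMF.abs_sum_toReal_mul_le {S : Type*} [Fintype S] (p : PMF S) {f : S → ℝ} {b : ℝ}
    (h : ∀ s, |f s| ≤ b) : |∑ s, (p s).toReal * f s| ≤ b := by
  refine (Finset.abs_sum_le_sum_abs _ _).trans ?_
  simp only [abs_mul, abs_of_nonneg ENNReal.toReal_nonneg]
  exact p.sum_toReal_mul_le h

namespace MDP

variable {S A : Type*}

/-! ### Policy evaluation -/

section Value

variable [Fintype S]

/-- The expectation of `g` at the next state under the policy `π`. -/
noncomputable def policyStep (M : MDP S A) (π : S → A) (g : S → ℝ) : S → ℝ :=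
  fun s => ∑ s', (M.P s (π s) s').toReal * g s'

lemma abs_iterate_policyStep_le (M : MDP S A) (π : S → A) {g : S → ℝ} {b : ℝ}
    (hg : ∀ s, |g s| ≤ b) (t : ℕ) (s : S) : |(M.policyStep π)^[t] g s| ≤ b := by
  induction t generalizing s with
  | zero => exact hg s
  | succ t ih =>
    rw [Function.iterate_succ_apply']
    exact PMF.abs_sum_toReal_mul_le _ ih

variable [MeasurableSpace S] [MeasurableSingletonClass S]

instance (M : MDP S A) (π : S → A) (s : S) : IsProbabilityMeasure (M.trajLaw π s) :=
  inferInstanceAs (IsProbabilityMeasure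
    (Kernel.trajMeasure (X := fun _ => S) (Measure.dirac s) (M.stepKernel π)))

lemma integral_trajLaw_zero (M : MDP S A) (π : S → A) (s : S) (g : S → ℝ) :
    ∫ w, g (w 0) ∂(M.trajLaw π s) = g s := by
  have hmap : (M.trajLaw π s).map (fun w => w 0) = Measure.dirac s := by
    have h0 : (fun w : ℕ → S => w 0) =
        (fun h : (i : Finset.Iic 0) → (fun _ : ℕ => S) i => h ⟨0, Finset.mem_Iic.2 le_rfl⟩) ∘
          Preorder.frestrictLe (π := fun _ => S) 0 := rfl
    rw [h0, ← Measure.map_map (measurable_pi_apply _) (by fun_prop), trajLaw, Kernel.trajMeasure,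
      Measure.map_comp _ _ (by fun_prop), Kernel.traj_map_frestrictLe, Kernel.partialTraj_self,
      Measure.id_comp]
    exact (congrArg _ (Measure.map_dirac' (MeasurableEquiv.measurable _) s)).trans
      (Measure.map_dirac' (measurable_pi_apply _) _)
  have hi := integral_map (μ := M.trajLaw π s) (φ := fun w => w 0) (f := g)
    (measurable_pi_apply 0).aemeasurable (measurable_of_finite g).aestronglyMeasurable
  rw [← hi, hmap, integral_dirac]

/-- Markov property: given the history up to `t`, the law of the next state depends only on the
state at `t`. -/
lemma integral_trajLaw_succ (M : MDP S A) (π : S → A) (s : S) (g : S → ℝ) (t : ℕ) :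
    ∫ w, g (w (t + 1)) ∂(M.trajLaw π s) = ∫ w, M.policyStep π g (w t) ∂(M.trajLaw π s) := by
  have hcomp := Kernel.map_frestrictLe_trajMeasure_compProd_eq_map_trajMeasure
    (X := fun _ => S) (μ₀ := Measure.dirac s) (κ := M.stepKernel π) (a := t)
  change (M.trajLaw π s).map _ ⊗ₘ _ = (M.trajLaw π s).map _ at hcomp
  have hg : Measurable fun p : ((i : Finset.Iic t) → (fun _ : ℕ => S) i) × S => g p.2 :=
    (measurable_of_finite g).comp measurable_snd
  have hm : Measurable fun w : ℕ → S =>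
      (Preorder.frestrictLe (π := fun _ => S) t w, w (t + 1)) := by fun_prop
  have h1 := integral_map (μ := M.trajLaw π s) hm.aemeasurable hg.aestronglyMeasurable
  rw [← hcomp, Measure.integral_compProd] at h1
  · rw [← h1, integral_map (by fun_prop)]
    · congr 1
      ext w
      change ∫ y, g y ∂(M.P (w t) (π (w t))).toMeasure = _
      rw [PMF.integral_eq_sum]
      rfl
    · exact (Measurable.aestronglyMeasurable (measurable_of_finite _))
  · obtain ⟨b, hb⟩ := (Set.finite_range fun x => ‖g x‖).bddAbove
    exact Integrable.of_bound hg.aestronglyMeasurable b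
      (Eventually.of_forall fun p => hb ⟨p.2, rfl⟩)

lemma integral_trajLaw (M : MDP S A) (π : S → A) (s : S) (g : S → ℝ) (t : ℕ) :
    ∫ w, g (w t) ∂(M.trajLaw π s) = (M.policyStep π)^[t] g s := by
  induction t generalizing g with
  | zero => exact M.integral_trajLaw_zero π s g
  | succ t ih => rw [integral_trajLaw_succ, ih, Function.iterate_succ_apply]

lemma value_eq_tsum (M : MDP S A) (π : S → A) (s : S) :
    M.value π s = ∑' t : ℕ, M.γ ^ t * (M.policyStep π)^[t] (fun s => M.c (s, π s)) s := by
  obtain ⟨b, hb⟩ := (Set.finite_range fun x => ‖M.c (x, π x)‖).bddAbove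
  have hb' : ∀ x, ‖M.c (x, π x)‖ ≤ b := fun x => hb ⟨x, rfl⟩
  have hterm : ∀ t : ℕ,
      Integrable (fun w : ℕ → S => M.γ ^ t * M.c (w t, π (w t))) (M.trajLaw π s) := fun t =>
    (Integrable.of_bound (f := fun w : ℕ → S => M.c (w t, π (w t)))
      ((measurable_of_finite fun x => M.c (x, π x)).comp
        (measurable_pi_apply t)).aestronglyMeasurable b
      (Eventually.of_forall fun w => hb' (w t))).const_mul _
  have hpow : ∀ t : ℕ, 0 ≤ M.γ ^ t := fun t => pow_nonneg M.γ_pos.le t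
  rw [value, ← integral_tsum_of_summable_integral_norm hterm]
  · refine tsum_congr fun t => ?_
    rw [integral_const_mul, M.integral_trajLaw π s (fun x => M.c (x, π x)) t]
  · refine Summable.of_nonneg_of_le (fun t => integral_nonneg fun w => norm_nonneg _) (fun t => ?_)
      ((summable_geometric_of_lt_one M.γ_pos.le M.γ_lt_one).mul_right b)
    calc ∫ w, ‖M.γ ^ t * M.c (w t, π (w t))‖ ∂(M.trajLaw π s)
        ≤ ∫ _, M.γ ^ t * b ∂(M.trajLaw π s) := by
          refine integral_mono (hterm t).norm (integrable_const _) fun w => ?_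
          simp only [norm_mul, Real.norm_of_nonneg (hpow t)]
          exact mul_le_mul_of_nonneg_left (hb' (w t)) (hpow t)
      _ = M.γ ^ t * b := by simp

lemma value_eq (M : MDP S A) (π : S → A) (s : S) :
    M.value π s = M.c (s, π s) + M.γ * M.policyStep π (M.value π) s := by
  obtain ⟨b, hb⟩ := (Set.finite_range fun x => |M.c (x, π x)|).bddAbove
  have hb' : ∀ x, |M.c (x, π x)| ≤ b := fun x => hb ⟨x, rfl⟩
  have hsum : ∀ x, Summable fun t : ℕ =>
      M.γ ^ t * (M.policyStep π)^[t] (fun s => M.c (s, π s)) x := fun x => by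
    refine Summable.of_norm_bounded
      ((summable_geometric_of_lt_one M.γ_pos.le M.γ_lt_one).mul_right b) fun t => ?_
    rw [norm_mul, Real.norm_of_nonneg (pow_nonneg M.γ_pos.le t)]
    exact mul_le_mul_of_nonneg_left (M.abs_iterate_policyStep_le π hb' t x)
      (pow_nonneg M.γ_pos.le t)
  rw [value_eq_tsum, (hsum s).tsum_eq_zero_add]
  simp only [pow_zero, one_mul, Function.iterate_zero, id_eq, add_right_inj]
  have hval : M.value π = fun x => ∑' t : ℕ,
      M.γ ^ t * (M.policyStep π)^[t] (fun s => M.c (s, π s)) x := funext (M.value_eq_tsum π)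
  rw [hval, policyStep]
  simp only [← tsum_mul_left]
  rw [← Summable.tsum_finsetSum fun i _ => (hsum i).mul_left _, ← tsum_mul_left]
  refine tsum_congr fun t => ?_
  rw [Function.iterate_succ_apply', policyStep, Finset.mul_sum, Finset.mul_sum]
  refine Finset.sum_congr rfl fun s' _ => ?_
  ring

/-- A subsolution of the evaluation equation of `π` lies below the value function of `π`. -/
lemma le_value_of_le (M : MDP S A) (π : S → A) {v : S → ℝ}
    (hv : ∀ s, v s ≤ M.c (s, π s) + M.γ * M.policyStep π v s) (s : S) : v s ≤ M.value π s := by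
  have : Nonempty S := ⟨s⟩
  -- Maximum principle: averaging cannot exceed the maximal gap, so that gap is at most γ times
  -- itself.
  obtain ⟨m, hm⟩ := Finite.exists_max fun x => v x - M.value π x
  have h1 : M.policyStep π v m - M.policyStep π (M.value π) m ≤ v m - M.value π m := by
    rw [policyStep, policyStep, ← Finset.sum_sub_distrib]
    simp only [← mul_sub]
    exact PMF.sum_toReal_mul_le _ hm
  have h2 : v m - M.value π m ≤ 0 := by
    have := hv m
    have := M.value_eq π m
    nlinarith [mul_le_mul_of_nonneg_left h1 M.γ_pos.le, M.γ_lt_one]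
  linarith [hm s]

/-- A supersolution of the evaluation equation of `π` lies above the value function of `π`. -/
lemma value_le_of_le (M : MDP S A) (π : S → A) {v : S → ℝ}
    (hv : ∀ s, M.c (s, π s) + M.γ * M.policyStep π v s ≤ v s) (s : S) : M.value π s ≤ v s := by
  have : Nonempty S := ⟨s⟩
  obtain ⟨m, hm⟩ := Finite.exists_max fun x => M.value π x - v x
  have h1 : M.policyStep π (M.value π) m - M.policyStep π v m ≤ M.value π m - v m := by
    rw [policyStep, policyStep, ← Finset.sum_sub_distrib]
    simp only [← mul_sub]
    exact PMF.sum_toReal_mul_le _ hm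
  have h2 : M.value π m - v m ≤ 0 := by
    have := hv m
    have := M.value_eq π m
    nlinarith [mul_le_mul_of_nonneg_left h1 M.γ_pos.le, M.γ_lt_one]
  linarith [hm s]

end Value

/-! ### The optimality equation and optimal policies -/

section Bellman

variable [Fintype A] [Nonempty A]

lemma minQ_le (q : S × A → ℝ) (s : S) (a : A) : minQ q s ≤ q (s, a) :=
  Finset.inf'_le _ (Finset.mem_univ a)

lemma exists_minQ_eq (q : S × A → ℝ) (s : S) : ∃ a, minQ q s = q (s, a) := by
  obtain ⟨a, -, ha⟩ := Finset.exists_mem_eq_inf' Finset.univ_nonempty fun a => q (s, a)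
  exact ⟨a, ha⟩

lemma minQ_add_const (q : S × A → ℝ) (b : ℝ) (s : S) :
    minQ (fun z => q z + b) s = minQ q s + b := by
  obtain ⟨a, ha⟩ := exists_minQ_eq q s
  obtain ⟨a', ha'⟩ := exists_minQ_eq (fun z => q z + b) s
  have := minQ_le q s a'
  have := minQ_le (fun z => q z + b) s a
  linarith

variable [Fintype S]

lemma abs_minQ_sub_le (q q' : S × A → ℝ) (s : S) : |minQ q s - minQ q' s| ≤ ‖q - q'‖ := by
  obtain ⟨a, ha⟩ := exists_minQ_eq q s
  obtain ⟨a', ha'⟩ := exists_minQ_eq q' s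
  have h1 := minQ_le q s a'
  have h2 := minQ_le q' s a
  have h3 : |q (s, a) - q' (s, a)| ≤ ‖q - q'‖ := norm_le_pi_norm (q - q') (s, a)
  have h4 : |q (s, a') - q' (s, a')| ≤ ‖q - q'‖ := norm_le_pi_norm (q - q') (s, a')
  rw [abs_le] at *
  constructor <;> linarith

lemma norm_bellmanQ_sub_le (M : MDP S A) (q q' : S × A → ℝ) :
    ‖M.bellmanQ q - M.bellmanQ q'‖ ≤ M.γ * ‖q - q'‖ := by
  refine (pi_norm_le_iff_of_nonneg (mul_nonneg M.γ_pos.le (norm_nonneg _))).2 fun z => ?_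
  have : (M.bellmanQ q - M.bellmanQ q') z =
      M.γ * ∑ s', (M.P z.1 z.2 s').toReal * (minQ q s' - minQ q' s') := by
    simp only [bellmanQ, Pi.sub_apply, mul_sub, Finset.sum_sub_distrib]
    ring
  rw [this, norm_mul, Real.norm_of_nonneg M.γ_pos.le]
  exact mul_le_mul_of_nonneg_left (PMF.abs_sum_toReal_mul_le _ (abs_minQ_sub_le q q')) M.γ_pos.le

lemma exists_bellmanQ_fixedPoint (M : MDP S A) : ∃ q : S × A → ℝ, q = M.bellmanQ q := by
  have hc : ContractingWith ⟨M.γ, M.γ_pos.le⟩ M.bellmanQ :=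
    ⟨M.γ_lt_one, LipschitzWith.of_dist_le_mul fun q q' => by
      rw [dist_eq_norm, dist_eq_norm]; exact M.norm_bellmanQ_sub_le q q'⟩
  exact ⟨_, hc.fixedPoint_isFixedPt.symm⟩

/-- For a policy greedy with respect to `q`, `minQ q` solves the evaluation equation; for every
other policy it is a subsolution. -/
lemma isOptimalQ_of_eq_bellmanQ [MeasurableSpace S] [MeasurableSingletonClass S] (M : MDP S A)
    {q : S × A → ℝ} (hq : q = M.bellmanQ q) : M.IsOptimalQ q := by
  choose π hπ using exists_minQ_eq q
  have hval : M.value π = minQ q := by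
    have h : ∀ s, minQ q s = M.c (s, π s) + M.γ * M.policyStep π (minQ q) s := fun s =>
      (hπ s).trans (congrFun hq (s, π s))
    exact funext fun s => le_antisymm (M.value_le_of_le π (fun s => (h s).ge) s)
      (M.le_value_of_le π (fun s => (h s).le) s)
  refine ⟨π, fun π' s => ?_, ?_⟩
  · rw [hval]
    exact M.le_value_of_le π' (fun s => (minQ_le q s (π' s)).trans (congrFun hq (s, π' s)).le) s
  · funext z
    rw [qValue, hval]
    exact congrFun hq z

end Bellman

end MDP

/-! ### Running averages and slowly varying weights -/

section Sequences

/-- Summation by parts for slowly varying weights. -/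
lemma abs_sum_mul_le_of_abs_sub_le {w : ℕ → ℝ} {b : ℝ} (hw : ∀ k, |w k| ≤ b)
    (hd : ∀ k : ℕ, |w (k + 1) - w k| ≤ b / ((k : ℝ) + 1)) (n : ℕ → ℝ) (k : ℕ) :
    |∑ l ∈ Finset.range k, w l * n l| ≤
      b * (|∑ l ∈ Finset.range k, n l| +
        ∑ l ∈ Finset.range k, |∑ j ∈ Finset.range (l + 1), n j| / ((l : ℝ) + 1)) := by
  have hparts : ∑ l ∈ Finset.range k, w l * n l = w k * ∑ l ∈ Finset.range k, n l -
      ∑ l ∈ Finset.range k, (w (l + 1) - w l) * ∑ j ∈ Finset.range (l + 1), n j := by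
    induction k with
    | zero => simp
    | succ k ih =>
      rw [Finset.sum_range_succ, ih, Finset.sum_range_succ _ k,
        Finset.sum_range_succ (fun l => (w (l + 1) - w l) * _) k, Finset.sum_range_succ n k]
      ring
  rw [hparts, mul_add]
  refine (abs_sub _ _).trans (add_le_add ?_ ?_)
  · rw [abs_mul]
    exact mul_le_mul_of_nonneg_right (hw k) (abs_nonneg _)
  · rw [Finset.mul_sum]
    refine (Finset.abs_sum_le_sum_abs _ _).trans (Finset.sum_le_sum fun l _ => ?_)
    rw [abs_mul]
    calc _ ≤ b / ((l : ℝ) + 1) * |∑ j ∈ Finset.range (l + 1), n j| :=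
          mul_le_mul_of_nonneg_right (hd l) (abs_nonneg _)
      _ = _ := by ring

/-- Summation by parts leaves the average at `k` and a Cesàro mean of earlier averages, both null.
-/
lemma tendsto_inv_mul_sum_mul_of_abs_sub_le {w : ℕ → ℝ} {b : ℝ} (hw : ∀ k, |w k| ≤ b)
    (hd : ∀ k : ℕ, |w (k + 1) - w k| ≤ b / ((k : ℝ) + 1)) {n : ℕ → ℝ}
    (hn : Tendsto (fun k : ℕ => (k : ℝ)⁻¹ * ∑ l ∈ Finset.range k, n l) atTop (𝓝 0)) :
    Tendsto (fun k : ℕ => (k : ℝ)⁻¹ * ∑ l ∈ Finset.range k, w l * n l) atTop (𝓝 0) := by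
  have h1 : Tendsto (fun k : ℕ => |(k : ℝ)⁻¹ * ∑ l ∈ Finset.range k, n l|) atTop (𝓝 0) := by
    simpa using hn.abs
  have h2 := (h1.comp (tendsto_add_atTop_nat 1)).cesaro
  have h3 := (h1.add h2).const_mul b
  rw [add_zero, mul_zero] at h3
  refine squeeze_zero_norm (fun k => ?_) h3
  have hk : (0 : ℝ) ≤ (k : ℝ)⁻¹ := by positivity
  rw [Real.norm_eq_abs, abs_mul, abs_of_nonneg hk]
  refine (mul_le_mul_of_nonneg_left (abs_sum_mul_le_of_abs_sub_le hw hd n k) hk).trans_eq ?_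
  have : ∀ l : ℕ, |∑ j ∈ Finset.range (l + 1), n j| / ((l : ℝ) + 1) =
      ((fun k : ℕ => |(k : ℝ)⁻¹ * ∑ l ∈ Finset.range k, n l|) ∘ fun a => a + 1) l := fun l => by
    have hl : (0 : ℝ) ≤ ((l : ℝ) + 1)⁻¹ := by positivity
    simp only [Function.comp_apply, Nat.cast_add, Nat.cast_one, abs_mul, abs_of_nonneg hl]
    ring
  rw [Finset.sum_congr rfl fun l _ => this l, abs_mul, abs_of_nonneg hk]
  ring

/-- A bounded sequence dominated by a contraction of its running averages plus a null sequence
tends to zero. -/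
lemma tendsto_zero_of_le_mul_average {ε η : ℕ → ℝ} {γ b : ℝ} (hγ₀ : 0 ≤ γ) (hγ : γ < 1)
    (hε₀ : ∀ k, 0 ≤ ε k) (hb : ∀ k, ε k ≤ b) (hη : Tendsto η atTop (𝓝 0))
    (h : ∀ᶠ k : ℕ in atTop, ε k ≤ γ * ((k : ℝ)⁻¹ * ∑ l ∈ Finset.range k, ε l) + η k) :
    Tendsto ε atTop (𝓝 0) := by
  -- An eventual bound `a` improves by the factor (1+γ)/2: the excess of early terms over `a`
  -- averages out, and the slack (1-γ)/2 · a absorbs it together with `η`.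
  have hstep : ∀ a : ℝ, 0 < a → (∀ᶠ k in atTop, ε k ≤ a) →
      ∀ᶠ k in atTop, ε k ≤ (1 + γ) / 2 * a := by
    intro a ha hea
    have hu : Tendsto (fun k => max (ε k - a) 0) atTop (𝓝 0) :=
      tendsto_const_nhds.congr' (hea.mono fun k hk => (max_eq_right (sub_nonpos.2 hk)).symm)
    have hsum := (hu.cesaro.const_mul γ).add hη
    rw [mul_zero, add_zero] at hsum
    filter_upwards [h, hsum.eventually_lt_const (show 0 < (1 - γ) / 2 * a by nlinarith),
      eventually_gt_atTop 0] with k hk hk' hk0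
    have hk0' : (0 : ℝ) < k := by exact_mod_cast hk0
    have hle : (k : ℝ)⁻¹ * ∑ l ∈ Finset.range k, ε l ≤
        a + (k : ℝ)⁻¹ * ∑ l ∈ Finset.range k, max (ε l - a) 0 := by
      calc (k : ℝ)⁻¹ * ∑ l ∈ Finset.range k, ε l
          ≤ (k : ℝ)⁻¹ * ∑ l ∈ Finset.range k, (a + max (ε l - a) 0) := by
            refine mul_le_mul_of_nonneg_left (Finset.sum_le_sum fun l _ => ?_) (by positivity)
            linarith [le_max_left (ε l - a) 0]
        _ = _ := by
            rw [Finset.sum_add_distrib, Finset.sum_const, Finset.card_range, nsmul_eq_mul]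
            field_simp
    nlinarith [mul_le_mul_of_nonneg_left hle hγ₀]
  have hb' : 0 < max b 1 := lt_max_of_lt_right one_pos
  have hpow : ∀ n : ℕ, ∀ᶠ k in atTop, ε k ≤ ((1 + γ) / 2) ^ n * max b 1 := by
    intro n
    induction n with
    | zero => exact Eventually.of_forall fun k => by simpa using Or.inl (hb k)
    | succ n ih =>
      have := hstep _ (by positivity) ih
      simpa only [pow_succ', mul_assoc] using this
  rw [Metric.tendsto_atTop']
  intro δ hδ
  have hlim := (tendsto_pow_atTop_nhds_zero_of_lt_one
    (show 0 ≤ (1 + γ) / 2 by linarith) (by linarith)).mul_const (max b 1)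
  rw [zero_mul] at hlim
  obtain ⟨n, hn⟩ := (hlim.eventually_lt_const hδ).exists
  obtain ⟨N, hN⟩ := eventually_atTop.1 (hpow n)
  refine ⟨N, fun k hk => ?_⟩
  rw [Real.dist_eq, sub_zero, abs_of_nonneg (hε₀ k)]
  exact (hN k hk.le).trans_lt hn

/-- The `k`-th term of a sequence plus the average of the preceding terms. -/
noncomputable def addAverage (ε : ℕ → ℝ) (k : ℕ) : ℝ :=
  ε k + (k : ℝ)⁻¹ * ∑ l ∈ Finset.range k, ε l

lemma addAverage_nonneg {ε : ℕ → ℝ} (h : ∀ k, 0 ≤ ε k) (k : ℕ) : 0 ≤ addAverage ε k :=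
  add_nonneg (h k) (mul_nonneg (by positivity) (Finset.sum_nonneg fun l _ => h l))

lemma tendsto_addAverage {ε : ℕ → ℝ} (h : Tendsto ε atTop (𝓝 0)) :
    Tendsto (addAverage ε) atTop (𝓝 0) := by
  have := h.add h.cesaro
  rwa [add_zero] at this

/-- The bound is kept for all `k`, not just eventually, so that the lemma can be applied again to
its own output. -/
lemma exists_addAverage_le {ε ρ : ℕ → ℝ} (hρ : ∀ k, 0 < ρ k)
    (hsum : (fun k => ∑ l ∈ Finset.range k, ρ l) =O[atTop] (fun k => (k : ℝ) * ρ k))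
    {b : ℝ} (hb : 0 ≤ b) (h : ∀ k, ε k ≤ b * ρ k) :
    ∃ b' : ℝ, 0 ≤ b' ∧ ∀ k, addAverage ε k ≤ b' * ρ k := by
  obtain ⟨C, hC, hCs⟩ := bound_of_isBigO_nat_atTop hsum
  refine ⟨b + b * C, by positivity, fun k => ?_⟩
  rcases Nat.eq_zero_or_pos k with rfl | hk
  · simp only [addAverage, Finset.range_zero, Finset.sum_empty, mul_zero, add_zero]
    nlinarith [h 0, mul_nonneg (mul_nonneg hb hC.le) (hρ 0).le]
  · have hk' : (0 : ℝ) < k := by exact_mod_cast hk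
    have h1 := hCs (x := k) (mul_pos hk' (hρ k)).ne'
    rw [Real.norm_of_nonneg (Finset.sum_nonneg fun l _ => (hρ l).le),
      Real.norm_of_nonneg (mul_pos hk' (hρ k)).le] at h1
    have h2 : ∑ l ∈ Finset.range k, ε l ≤ b * ∑ l ∈ Finset.range k, ρ l := by
      rw [Finset.mul_sum]
      exact Finset.sum_le_sum fun l _ => h l
    have h3 : (k : ℝ)⁻¹ * ∑ l ∈ Finset.range k, ε l ≤ b * C * ρ k := by
      rw [inv_mul_le_iff₀ hk']
      nlinarith [mul_le_mul_of_nonneg_left h1 hb]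
    rw [addAverage]
    linarith [h k]

end Sequences

/-! ### Pathwise convergence of Q-learning -/

namespace MDP

variable {S A : Type*} [Fintype A] [Nonempty A]

lemma stepSize_pos (k : ℕ) : 0 < stepSize k := by
  rw [stepSize]; positivity

lemma stepSize_le_one (k : ℕ) : stepSize k ≤ 1 := by
  rw [stepSize, div_le_one (by positivity)]
  linarith [Nat.cast_nonneg (α := ℝ) k]

lemma empBellmanQ_add_const (M : MDP S A) (x : S × A → S) (q : S × A → ℝ) (b : ℝ) (z : S × A) :
    M.empBellmanQ x (fun y => q y + b) z = M.empBellmanQ x q z + M.γ * b := by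
  rw [empBellmanQ, empBellmanQ, minQ_add_const]
  ring

lemma qlIter_succ (M : MDP S A) (x : ℕ → S × A → S) (q₀ : S × A → ℝ) (k : ℕ) (z : S × A) :
    M.qlIter x q₀ (k + 1) z = (1 - stepSize k) * M.qlIter x q₀ k z +
      stepSize k * M.empBellmanQ (x k) (M.qlIter x q₀ k) z := by
  rw [qlIter]; ring

/-- The Q-learning iterates are the running averages of the empirical Bellman updates. -/
lemma mul_qlIter (M : MDP S A) (x : ℕ → S × A → S) (q₀ : S × A → ℝ) (k : ℕ) (z : S × A) :
    (k : ℝ) * M.qlIter x q₀ k z =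
      ∑ l ∈ Finset.range k, M.empBellmanQ (x l) (M.qlIter x q₀ l) z := by
  induction k with
  | zero => simp
  | succ k ih =>
    have hk : (k : ℝ) + 1 ≠ 0 := by positivity
    rw [Finset.sum_range_succ, ← ih, qlIter_succ, stepSize]
    push_cast
    field_simp
    ring

/-- Shifting the initialization of Q-learning by a constant shifts all iterates by constants. -/
lemma qlIter_add_const (M : MDP S A) (x : ℕ → S × A → S) (q₀ : S × A → ℝ) (b : ℝ) (k : ℕ)
    (z : S × A) :
    M.qlIter x (fun y => q₀ y + b) k z =
      M.qlIter x q₀ k z + b * ∏ l ∈ Finset.range k, (1 - (1 - M.γ) * stepSize l) := by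
  induction k generalizing z with
  | zero => simp [qlIter]
  | succ k ih =>
    have h : M.qlIter x (fun y => q₀ y + b) k = fun y => M.qlIter x q₀ k y +
      b * ∏ l ∈ Finset.range k, (1 - (1 - M.γ) * stepSize l) := funext ih
    rw [qlIter_succ, qlIter_succ, ih, h, empBellmanQ_add_const, Finset.prod_range_succ]
    ring

variable [Fintype S]

lemma abs_empBellmanQ_sub_le (M : MDP S A) (x : S × A → S) (q q' : S × A → ℝ) (z : S × A) :
    |M.empBellmanQ x q z - M.empBellmanQ x q' z| ≤ M.γ * ‖q - q'‖ := by
  rw [empBellmanQ, empBellmanQ, add_sub_add_left_eq_sub, ← mul_sub, abs_mul,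
    abs_of_nonneg M.γ_pos.le]
  exact mul_le_mul_of_nonneg_left (abs_minQ_sub_le q q' _) M.γ_pos.le

lemma abs_minQ_le (q : S × A → ℝ) (s : S) : |minQ q s| ≤ ‖q‖ := by
  obtain ⟨a, ha⟩ := exists_minQ_eq q s
  rw [ha]
  exact norm_le_pi_norm q (s, a)

lemma abs_empBellmanQ_le (M : MDP S A) (x : S × A → S) (q : S × A → ℝ) (z : S × A) :
    |M.empBellmanQ x q z| ≤ ‖M.c‖ + M.γ * ‖q‖ := by
  refine (abs_add_le _ _).trans (add_le_add (norm_le_pi_norm M.c z) ?_)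
  rw [abs_mul, abs_of_nonneg M.γ_pos.le]
  exact mul_le_mul_of_nonneg_left (abs_minQ_le q _) M.γ_pos.le

/-- The Q-learning iterates and their empirical Bellman updates are bounded. -/
lemma exists_norm_qlIter_le (M : MDP S A) (x : ℕ → S × A → S) (q₀ : S × A → ℝ) :
    ∃ b : ℝ, 0 ≤ b ∧ (∀ k, ‖M.qlIter x q₀ k‖ ≤ b) ∧
      ∀ k z, |M.empBellmanQ (x k) (M.qlIter x q₀ k) z| ≤ b := by
  have hγ : 0 < 1 - M.γ := sub_pos.2 M.γ_lt_one
  -- The ball of radius `b` contains `q₀` and is invariant, because ‖c‖ + γb ≤ b.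
  set b := max ‖q₀‖ (‖M.c‖ / (1 - M.γ)) with hb
  have hb0 : 0 ≤ b := le_max_of_le_left (norm_nonneg _)
  have hc : ‖M.c‖ + M.γ * b ≤ b := by
    have : ‖M.c‖ / (1 - M.γ) ≤ b := le_max_right _ _
    rw [div_le_iff₀ hγ] at this
    linarith
  have hT : ∀ k, ‖M.qlIter x q₀ k‖ ≤ b →
      ∀ z, |M.empBellmanQ (x k) (M.qlIter x q₀ k) z| ≤ b := fun k hk z =>
    (M.abs_empBellmanQ_le (x k) _ z).trans
      ((add_le_add_right (mul_le_mul_of_nonneg_left hk M.γ_pos.le) _).trans hc)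
  have hq : ∀ k, ‖M.qlIter x q₀ k‖ ≤ b := by
    intro k
    induction k with
    | zero => exact le_max_left _ _
    | succ k ih =>
      refine (pi_norm_le_iff_of_nonneg hb0).2 fun z => ?_
      rw [qlIter_succ]
      have h1 : |M.qlIter x q₀ k z| ≤ b := (norm_le_pi_norm _ z).trans ih
      have h2 := hT k ih z
      have h3 := stepSize_pos k
      have h4 := stepSize_le_one k
      rw [Real.norm_eq_abs]
      rw [abs_le] at *
      constructor <;> nlinarith
  exact ⟨b, hb0, hq, fun k => hT k (hq k)⟩

open Classical in
-- This isolates the randomness in finitely many centred indicators, weighted by the slowly varying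
-- `minQ q s'`.
lemma empBellmanQ_sub_bellmanQ (M : MDP S A) (x : S × A → S) (q : S × A → ℝ) (z : S × A) :
    M.empBellmanQ x q z - M.bellmanQ q z =
      M.γ * ∑ s', minQ q s' * ((if x z = s' then 1 else 0) - (M.P z.1 z.2 s').toReal) := by
  simp only [empBellmanQ, bellmanQ, mul_sub, Finset.sum_sub_distrib, mul_ite, mul_one, mul_zero,
    Finset.sum_ite_eq, Finset.mem_univ, if_true]
  simp only [mul_comm]
  ring

open Classical in
/-- Q-learning converges along every sample path with the right empirical frequencies. -/
lemma tendsto_norm_qlIter_sub (M : MDP S A) (x : ℕ → S × A → S) (q₀ qStar : S × A → ℝ)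
    (hq : qStar = M.bellmanQ qStar)
    (hx : ∀ z s', Tendsto (fun k : ℕ => (k : ℝ)⁻¹ * ∑ l ∈ Finset.range k,
      ((if x l z = s' then 1 else 0) - (M.P z.1 z.2 s').toReal)) atTop (𝓝 0)) :
    Tendsto (fun k => ‖M.qlIter x q₀ k - qStar‖) atTop (𝓝 0) := by
  obtain ⟨b, hb0, hb, hTb⟩ := M.exists_norm_qlIter_le x q₀
  set Q := M.qlIter x q₀ with hQ
  have hV : ∀ s' k, |minQ (Q k) s'| ≤ 2 * b := fun s' k => by
    linarith [abs_minQ_le (Q k) s', hb k]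
  have hdV : ∀ s' (k : ℕ), |minQ (Q (k + 1)) s' - minQ (Q k) s'| ≤ 2 * b / ((k : ℝ) + 1) := by
    intro s' k
    refine (abs_minQ_sub_le _ _ _).trans ((pi_norm_le_iff_of_nonneg (by positivity)).2 fun z => ?_)
    have h1 : Q (k + 1) z - Q k z =
        (M.empBellmanQ (x k) (Q k) z - Q k z) / ((k : ℝ) + 1) := by
      rw [hQ, qlIter_succ, stepSize]; ring
    rw [Pi.sub_apply, h1, Real.norm_eq_abs, abs_div, abs_of_nonneg (by positivity : (0:ℝ) ≤ k + 1)]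
    refine div_le_div_of_nonneg_right ?_ (by positivity)
    have h2 : |Q k z| ≤ b := (norm_le_pi_norm _ z).trans (hb k)
    linarith [abs_sub (M.empBellmanQ (x k) (Q k) z) (Q k z), hTb k z]
  -- `ζ z k` is the averaged sampling noise along the QL iterates.
  set ζ : S × A → ℕ → ℝ := fun z k => M.γ * ∑ s', (k : ℝ)⁻¹ * ∑ l ∈ Finset.range k,
    minQ (Q l) s' * ((if x l z = s' then 1 else 0) - (M.P z.1 z.2 s').toReal) with hζ
  have hζ0 : ∀ z, Tendsto (ζ z) atTop (𝓝 0) := fun z => by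
    have := (tendsto_finsetSum Finset.univ fun s' _ =>
      tendsto_inv_mul_sum_mul_of_abs_sub_le (hV s') (hdV s') (hx z s')).const_mul M.γ
    simpa only [Finset.sum_const_zero, mul_zero] using this
  have hη : Tendsto (fun k => ∑ z, |ζ z k|) atTop (𝓝 0) := by
    simpa using tendsto_finsetSum Finset.univ fun z _ => (hζ0 z).abs
  refine tendsto_zero_of_le_mul_average (γ := M.γ) (b := b + ‖qStar‖) M.γ_pos.le M.γ_lt_one
    (fun k => norm_nonneg _) (fun k => (norm_sub_le _ _).trans (add_le_add_left (hb k) _)) hη ?_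
  filter_upwards [eventually_gt_atTop 0] with k hk
  have hk' : (0 : ℝ) < k := by exact_mod_cast hk
  have hS : 0 ≤ ∑ l ∈ Finset.range k, ‖Q l - qStar‖ := Finset.sum_nonneg fun l _ => norm_nonneg _
  refine (pi_norm_le_iff_of_nonneg (add_nonneg (mul_nonneg M.γ_pos.le (by positivity))
    (Finset.sum_nonneg fun z _ => abs_nonneg _))).2 fun z => ?_
  have hdecomp : (Q k - qStar) z = (k : ℝ)⁻¹ * ∑ l ∈ Finset.range k,
      (M.bellmanQ (Q l) - M.bellmanQ qStar) z + ζ z k := by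
    have h1 : ζ z k = (k : ℝ)⁻¹ * ∑ l ∈ Finset.range k,
        (M.empBellmanQ (x l) (Q l) z - M.bellmanQ (Q l) z) := by
      simp only [empBellmanQ_sub_bellmanQ, hζ]
      rw [← Finset.mul_sum, ← Finset.mul_sum, Finset.sum_comm]
      ring
    have h2 : Q k z = (k : ℝ)⁻¹ * ∑ l ∈ Finset.range k, M.empBellmanQ (x l) (Q l) z := by
      rw [← mul_qlIter, inv_mul_cancel_left₀ hk'.ne']
    rw [h1, Pi.sub_apply, h2, ← mul_add, ← Finset.sum_add_distrib]
    simp only [Pi.sub_apply, ← hq]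
    rw [Finset.sum_congr rfl fun l _ => show M.bellmanQ (Q l) z - qStar z +
      (M.empBellmanQ (x l) (Q l) z - M.bellmanQ (Q l) z) =
        M.empBellmanQ (x l) (Q l) z - qStar z by ring]
    rw [Finset.sum_sub_distrib, Finset.sum_const, Finset.card_range, nsmul_eq_mul, mul_sub,
      inv_mul_cancel_left₀ hk'.ne']
  rw [hdecomp]
  refine (norm_add_le _ _).trans (add_le_add ?_ ?_)
  · rw [norm_mul, Real.norm_of_nonneg (by positivity : (0:ℝ) ≤ (k : ℝ)⁻¹), mul_left_comm,
      Finset.mul_sum]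
    refine mul_le_mul_of_nonneg_left ?_ (by positivity)
    exact (norm_sum_le _ _).trans (Finset.sum_le_sum fun l _ =>
      (norm_le_pi_norm _ z).trans (M.norm_bellmanQ_sub_le _ _))
  · exact Finset.single_le_sum (f := fun z => |ζ z k|) (fun z _ => abs_nonneg _)
      (Finset.mem_univ z)

end MDP

/-! ### Rank-one Q-learning compared with Q-learning -/

namespace MDP

variable {S A : Type*} [Fintype A] [Fintype S]

lemma pushMass_mem_stdSimplex (x : S × A → S) (a : S × A → A) {d : S × A → ℝ}
    (hd : d ∈ stdSimplex ℝ (S × A)) : pushMass x a d ∈ stdSimplex ℝ (S × A) := by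
  classical
  refine ⟨fun y => Finset.sum_nonneg fun z _ => ?_, ?_⟩
  · split_ifs
    exacts [hd.1 z, le_rfl]
  · simp only [pushMass]
    rw [Finset.sum_comm, ← hd.2]
    exact Finset.sum_congr rfl fun z _ => by simp

lemma normalizeL1_of_mem_stdSimplex {d : S × A → ℝ} (hd : d ∈ stdSimplex ℝ (S × A)) :
    normalizeL1 d = d := by
  funext y
  rw [normalizeL1, Finset.sum_congr rfl fun z _ => abs_of_nonneg (hd.1 z), hd.2, div_one]

namespace IsR1QLRun

variable [Nonempty A] {M : MDP S A} {x : ℕ → S × A → S} {q₀ d₀ : S × A → ℝ} {q d : ℕ → S × A → ℝ}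
  {a : ℕ → S × A → A}

lemma d_mem_stdSimplex (h : M.IsR1QLRun x q₀ d₀ q d a) (hd₀ : d₀ ∈ stdSimplex ℝ (S × A)) (k : ℕ) :
    d k ∈ stdSimplex ℝ (S × A) := by
  induction k with
  | zero => rwa [h.d_zero]
  | succ k ih =>
    have hmem := convex_stdSimplex ℝ (S × A) ih (pushMass_mem_stdSimplex (x k) (a k) ih)
      (sub_nonneg.2 (stepSize_le_one k)) (stepSize_pos k).le (sub_add_cancel _ _)
    rw [h.d_succ, normalizeL1_of_mem_stdSimplex hmem]
    exact hmem

/-- The increment is the step size times a difference of two numbers in [0,1]. This is the slow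
variation needed for summation by parts. -/
lemma abs_d_sub_le (h : M.IsR1QLRun x q₀ d₀ q d a) (hd₀ : d₀ ∈ stdSimplex ℝ (S × A)) (k : ℕ)
    (z : S × A) : |d (k + 1) z - d k z| ≤ stepSize k := by
  have ih := h.d_mem_stdSimplex hd₀ k
  have hf := pushMass_mem_stdSimplex (x k) (a k) ih
  have hmem := convex_stdSimplex ℝ (S × A) ih hf
    (sub_nonneg.2 (stepSize_le_one k)) (stepSize_pos k).le (sub_add_cancel _ _)
  rw [h.d_succ, normalizeL1_of_mem_stdSimplex hmem]
  have h1 : ((1 - stepSize k) • d k + stepSize k • pushMass (x k) (a k) (d k)) z - d k z =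
      stepSize k * (pushMass (x k) (a k) (d k) z - d k z) := by
    simp only [Pi.add_apply, Pi.smul_apply, smul_eq_mul]; ring
  rw [h1, abs_mul, abs_of_pos (stepSize_pos k)]
  refine mul_le_of_le_one_right (stepSize_pos k).le (abs_le.2 ?_)
  have h2 := mem_Icc_of_mem_stdSimplex ih z
  have h3 := mem_Icc_of_mem_stdSimplex hf z
  constructor <;> linarith [h2.1, h2.2, h3.1, h3.2]

/-- Rank-one Q-learning differs from Q-learning driven by the same samples by a constant vector,
which is a running average of weighted Bellman residuals of Q-learning. -/
lemma eq_qlIter_add (h : M.IsR1QLRun x q₀ d₀ q d a) (hd₀ : d₀ ∈ stdSimplex ℝ (S × A)) (k : ℕ)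
    (z : S × A) :
    q k z = M.qlIter x q₀ k z + (k : ℝ)⁻¹ * (M.γ / (1 - M.γ) * ∑ l ∈ Finset.range k,
      ∑ y, d (l + 1) y * (M.empBellmanQ (x l) (M.qlIter x q₀ l) y - M.qlIter x q₀ l y)) := by
  have hγ : 1 - M.γ ≠ 0 := (sub_pos.2 M.γ_lt_one).ne'
  induction k generalizing z with
  | zero => simp [h.q_zero, qlIter]
  | succ k ih =>
    set Q := M.qlIter x q₀ with hQ
    set b := (k : ℝ)⁻¹ * (M.γ / (1 - M.γ) * ∑ l ∈ Finset.range k,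
      ∑ y, d (l + 1) y * (M.empBellmanQ (x l) (Q l) y - Q l y)) with hb
    have hq : q k = fun y => Q k y + b := funext ih
    -- At `k = 0` the sum is empty, so the default value 0⁻¹ = 0 is harmless.
    have hkb : (k : ℝ) * b = M.γ / (1 - M.γ) * ∑ l ∈ Finset.range k,
        ∑ y, d (l + 1) y * (M.empBellmanQ (x l) (Q l) y - Q l y) := by
      rcases Nat.eq_zero_or_pos k with rfl | hk
      · simp
      · rw [hb, mul_inv_cancel_left₀ (by positivity)]
    -- Times γ/(1-γ), the drop (1-γ)b becomes γb and cancels the shift γb of the empirical update.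
    have hsum : ∑ y, d (k + 1) y * (M.empBellmanQ (x k) (q k) y - q k y) =
        ∑ y, d (k + 1) y * (M.empBellmanQ (x k) (Q k) y - Q k y) - (1 - M.γ) * b := by
      calc _ = ∑ y, (d (k + 1) y * (M.empBellmanQ (x k) (Q k) y - Q k y) -
              d (k + 1) y * ((1 - M.γ) * b)) := by
            refine Finset.sum_congr rfl fun y _ => ?_
            rw [hq, empBellmanQ_add_const]
            ring
        _ = _ := by
            rw [Finset.sum_sub_distrib, ← Finset.sum_mul, (h.d_mem_stdSimplex hd₀ (k + 1)).2,
              one_mul]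
    rw [h.q_succ, hsum, hq, empBellmanQ_add_const, Finset.sum_range_succ,
      mul_add (M.γ / (1 - M.γ)), ← hkb, hQ, qlIter_succ, stepSize]
    have hk : (k : ℝ) + 1 ≠ 0 := by positivity
    push_cast
    field_simp
    ring

/-- The 2 pays for replacing QL residuals by the noise at `qStar`, the cardinality for one weighted
noise sum per pair. -/
lemma norm_sub_le (h : M.IsR1QLRun x q₀ d₀ q d a) (hd₀ : d₀ ∈ stdSimplex ℝ (S × A))
    (qStar : S × A → ℝ) (k : ℕ) :
    ‖q k - qStar‖ ≤ ‖M.qlIter x q₀ k - qStar‖ +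
      M.γ / (1 - M.γ) * (2 + Fintype.card (S × A)) *
        (addAverage (fun l => ‖M.qlIter x q₀ l - qStar‖) k + (k : ℝ)⁻¹ * ∑ l ∈ Finset.range k,
          addAverage (fun l => ‖M.qlIter x q₀ l - qStar‖) (l + 1)) := by
  set Q := M.qlIter x q₀ with hQ
  set ε : ℕ → ℝ := fun l => ‖Q l - qStar‖ with hε
  have hε0 : ∀ l, 0 ≤ ε l := fun l => norm_nonneg _
  have hγ : 0 < 1 - M.γ := sub_pos.2 M.γ_lt_one
  have hγ' : 0 ≤ M.γ / (1 - M.γ) := div_nonneg M.γ_pos.le hγ.le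
  have hE0 := addAverage_nonneg hε0
  set D : ℝ := addAverage ε k + (k : ℝ)⁻¹ * ∑ l ∈ Finset.range k, addAverage ε (l + 1) with hD
  have hD0 : 0 ≤ D :=
    add_nonneg (hE0 k) (mul_nonneg (by positivity) (Finset.sum_nonneg fun l _ => hE0 _))
  have hC : 0 ≤ M.γ / (1 - M.γ) * (2 + Fintype.card (S × A)) * D := by positivity
  set e : ℝ := (k : ℝ)⁻¹ * (M.γ / (1 - M.γ) * ∑ l ∈ Finset.range k,
      ∑ y, d (l + 1) y * (M.empBellmanQ (x l) (Q l) y - Q l y)) with he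
  suffices hb : |e| ≤ M.γ / (1 - M.γ) * (2 + Fintype.card (S × A)) * D by
    refine (pi_norm_le_iff_of_nonneg (add_nonneg (norm_nonneg _) hC)).2 fun z => ?_
    have hz : (q k - qStar) z = (Q k - qStar) z + e := by
      rw [Pi.sub_apply, Pi.sub_apply, h.eq_qlIter_add hd₀]
      ring
    rw [hz]
    exact (norm_add_le _ _).trans (add_le_add (norm_le_pi_norm (Q k - qStar) z) hb)
  rcases Nat.eq_zero_or_pos k with rfl | hk
  · simpa [he] using hC
  have hk' : (0 : ℝ) < k := by exact_mod_cast hk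
  -- Since j·Q_j is the sum of the updates, the noise sum is j(Q_j - q⋆) plus differences of updates
  -- at q⋆ and at Q_l.
  have hnoise : ∀ (j : ℕ) (y : S × A),
      |∑ l ∈ Finset.range j, (M.empBellmanQ (x l) qStar y - qStar y)| ≤ j * addAverage ε j := by
    intro j y
    have h1 : ∑ l ∈ Finset.range j, (M.empBellmanQ (x l) qStar y - qStar y) =
        j * (Q j - qStar) y + ∑ l ∈ Finset.range j,
          (M.empBellmanQ (x l) qStar y - M.empBellmanQ (x l) (Q l) y) := by
      rw [Pi.sub_apply, mul_sub, hQ, mul_qlIter, Finset.sum_sub_distrib, Finset.sum_sub_distrib,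
        Finset.sum_const, Finset.card_range, nsmul_eq_mul]
      ring
    have h2 : (j : ℝ) * addAverage ε j = j * ε j + ∑ l ∈ Finset.range j, ε l := by
      rcases Nat.eq_zero_or_pos j with rfl | hj
      · simp
      · rw [addAverage, mul_add, mul_inv_cancel_left₀ (by positivity)]
    rw [h1, h2]
    refine (abs_add_le _ _).trans (add_le_add ?_ ?_)
    · rw [abs_mul, Nat.abs_cast]
      exact mul_le_mul_of_nonneg_left (norm_le_pi_norm (Q j - qStar) y) (Nat.cast_nonneg _)
    · refine (Finset.abs_sum_le_sum_abs _ _).trans (Finset.sum_le_sum fun l _ => ?_)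
      refine (M.abs_empBellmanQ_sub_le _ _ _ _).trans ?_
      rw [norm_sub_rev]
      exact mul_le_of_le_one_left (norm_nonneg _) M.γ_lt_one.le
  have hweighted : ∀ y, |∑ l ∈ Finset.range k,
      d (l + 1) y * (M.empBellmanQ (x l) qStar y - qStar y)| ≤ k * D := by
    intro y
    have hw : ∀ l, |d (l + 1) y| ≤ 1 := fun l => by
      have := mem_Icc_of_mem_stdSimplex (h.d_mem_stdSimplex hd₀ (l + 1)) y
      exact abs_le.2 ⟨by linarith [this.1], this.2⟩
    have hdw : ∀ l : ℕ, |d (l + 1 + 1) y - d (l + 1) y| ≤ 1 / ((l : ℝ) + 1) := fun l => by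
      refine (h.abs_d_sub_le hd₀ (l + 1) y).trans ?_
      rw [stepSize]
      push_cast
      exact one_div_le_one_div_of_le (by positivity) (by linarith)
    refine (abs_sum_mul_le_of_abs_sub_le (w := fun l => d (l + 1) y) hw hdw _ k).trans ?_
    rw [one_mul, hD, mul_add, mul_inv_cancel_left₀ hk'.ne']
    refine add_le_add (hnoise k y) (Finset.sum_le_sum fun l _ => ?_)
    rw [div_le_iff₀ (by positivity), mul_comm]
    exact_mod_cast hnoise (l + 1) y
  have hres : ∀ l, |∑ y, d (l + 1) y * ((M.empBellmanQ (x l) (Q l) y - Q l y) -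
      (M.empBellmanQ (x l) qStar y - qStar y))| ≤ 2 * ε l := by
    intro l
    have hmem := h.d_mem_stdSimplex hd₀ (l + 1)
    calc _ ≤ ∑ y, d (l + 1) y * (2 * ε l) := by
          refine (Finset.abs_sum_le_sum_abs _ _).trans (Finset.sum_le_sum fun y _ => ?_)
          rw [abs_mul, abs_of_nonneg (hmem.1 y)]
          refine mul_le_mul_of_nonneg_left ?_ (hmem.1 y)
          have h1 := M.abs_empBellmanQ_sub_le (x l) (Q l) qStar y
          have h2 : |Q l y - qStar y| ≤ ε l := norm_le_pi_norm (Q l - qStar) y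
          have h3 : M.γ * ε l ≤ ε l := mul_le_of_le_one_left (hε0 l) M.γ_lt_one.le
          have h4 : |M.empBellmanQ (x l) (Q l) y - M.empBellmanQ (x l) qStar y| ≤ ε l := h1.trans h3
          rw [abs_le] at *
          constructor <;> linarith [h2.1, h2.2, h4.1, h4.2]
      _ = 2 * ε l := by rw [← Finset.sum_mul, hmem.2, one_mul]
  have hsplit : ∑ l ∈ Finset.range k, ∑ y, d (l + 1) y * (M.empBellmanQ (x l) (Q l) y - Q l y) =
      ∑ l ∈ Finset.range k, ∑ y, d (l + 1) y * ((M.empBellmanQ (x l) (Q l) y - Q l y) -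
        (M.empBellmanQ (x l) qStar y - qStar y)) +
      ∑ y, ∑ l ∈ Finset.range k, d (l + 1) y * (M.empBellmanQ (x l) qStar y - qStar y) := by
    rw [Finset.sum_comm (s := Finset.univ), ← Finset.sum_add_distrib]
    refine Finset.sum_congr rfl fun l _ => ?_
    rw [← Finset.sum_add_distrib]
    exact Finset.sum_congr rfl fun y _ => by ring
  have hεD : ∑ l ∈ Finset.range k, ε l ≤ k * D := by
    have h1 : (k : ℝ)⁻¹ * ∑ l ∈ Finset.range k, ε l ≤ D := by
      have h2 : 0 ≤ (k : ℝ)⁻¹ * ∑ l ∈ Finset.range k, addAverage ε (l + 1) :=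
        mul_nonneg (by positivity) (Finset.sum_nonneg fun l _ => hE0 _)
      have h3 : addAverage ε k = ε k + (k : ℝ)⁻¹ * ∑ l ∈ Finset.range k, ε l := rfl
      rw [hD, h3]
      linarith [hε0 k]
    rwa [inv_mul_le_iff₀ hk'] at h1
  have htotal : |∑ l ∈ Finset.range k,
      ∑ y, d (l + 1) y * (M.empBellmanQ (x l) (Q l) y - Q l y)| ≤
        k * ((2 + Fintype.card (S × A)) * D) := by
    rw [hsplit]
    have h1 := (Finset.abs_sum_le_sum_abs _ _).trans
      (Finset.sum_le_sum fun l (_ : l ∈ Finset.range k) => hres l)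
    have h2 := (Finset.abs_sum_le_sum_abs _ _).trans
      (Finset.sum_le_sum fun y (_ : y ∈ (Finset.univ : Finset (S × A))) => hweighted y)
    rw [← Finset.mul_sum] at h1
    rw [Finset.sum_const, Finset.card_univ, nsmul_eq_mul] at h2
    refine (abs_add_le _ _).trans ((add_le_add h1 h2).trans ?_)
    linarith
  rw [he, abs_mul, abs_mul, abs_of_nonneg hγ', abs_of_pos (inv_pos.2 hk'), inv_mul_le_iff₀ hk']
  calc _ ≤ M.γ / (1 - M.γ) * (k * ((2 + Fintype.card (S × A)) * D)) :=
        mul_le_mul_of_nonneg_left htotal hγ'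
    _ = _ := by ring

lemma tendsto_of_tendsto_qlIter (h : M.IsR1QLRun x q₀ d₀ q d a) (hd₀ : d₀ ∈ stdSimplex ℝ (S × A))
    {qStar : S × A → ℝ} (hql : Tendsto (fun k => ‖M.qlIter x q₀ k - qStar‖) atTop (𝓝 0)) :
    Tendsto q atTop (𝓝 qStar) := by
  rw [tendsto_iff_norm_sub_tendsto_zero]
  have h1 := tendsto_addAverage hql
  have h2 := hql.add ((h1.add (h1.comp (tendsto_add_atTop_nat 1)).cesaro).const_mul
    (M.γ / (1 - M.γ) * (2 + Fintype.card (S × A))))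
  simp only [add_zero, mul_zero] at h2
  exact squeeze_zero (fun k => norm_nonneg _) (h.norm_sub_le hd₀ qStar) h2

/-- The bound of `norm_sub_le` nests two averages, so `exists_addAverage_le` is used twice. -/
lemma isBigO_of_isBigO_qlIter (h : M.IsR1QLRun x q₀ d₀ q d a) (hd₀ : d₀ ∈ stdSimplex ℝ (S × A))
    {qStar : S × A → ℝ} {ρ : ℕ → ℝ} (hρ : ∀ k, 0 < ρ k)
    (hsum : (fun k => ∑ l ∈ Finset.range k, ρ l) =O[atTop] (fun k => (k : ℝ) * ρ k))
    (hql : (fun k => ‖M.qlIter x q₀ k - qStar‖) =O[atTop] ρ) :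
    (fun k => ‖q k - qStar‖) =O[atTop] ρ := by
  have hγ : 0 < 1 - M.γ := sub_pos.2 M.γ_lt_one
  have hK : 0 ≤ M.γ / (1 - M.γ) * (2 + Fintype.card (S × A)) :=
    mul_nonneg (div_nonneg M.γ_pos.le hγ.le) (by positivity)
  obtain ⟨b₀, hb₀, hε⟩ := bound_of_isBigO_nat_atTop hql
  replace hε : ∀ k, ‖M.qlIter x q₀ k - qStar‖ ≤ b₀ * ρ k := fun k => by
    simpa only [norm_norm, Real.norm_of_nonneg (hρ k).le] using hε (hρ k).ne'
  obtain ⟨b₁, hb₁, hD⟩ := exists_addAverage_le hρ hsum hb₀.le hε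
  obtain ⟨b₂, hb₂, hDD⟩ := exists_addAverage_le hρ hsum hb₁ hD
  set D := addAverage fun l => ‖M.qlIter x q₀ l - qStar‖ with hDdef
  have hD0 : ∀ k, 0 ≤ D k := addAverage_nonneg fun l => norm_nonneg _
  refine IsBigO.of_bound (b₀ + M.γ / (1 - M.γ) * (2 + Fintype.card (S × A)) * (b₁ + b₂)) ?_
  filter_upwards [eventually_gt_atTop 0] with k hk
  have hk' : (1 : ℝ) ≤ k := by exact_mod_cast hk
  -- Shifting the index costs one extra term `D k`, divided by k ≥ 1.
  have hshift : (k : ℝ)⁻¹ * ∑ l ∈ Finset.range k, D (l + 1) ≤ addAverage D k := by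
    have h1 : ∑ l ∈ Finset.range k, D (l + 1) ≤ ∑ l ∈ Finset.range k, D l + D k := by
      have h2 := Finset.sum_range_succ' D k
      rw [Finset.sum_range_succ] at h2
      linarith [hD0 0]
    have h3 : (k : ℝ)⁻¹ * D k ≤ D k := mul_le_of_le_one_left (hD0 k) (inv_le_one_of_one_le₀ hk')
    have h4 := mul_le_mul_of_nonneg_left h1 (by positivity : (0 : ℝ) ≤ (k : ℝ)⁻¹)
    rw [mul_add] at h4
    rw [addAverage]
    linarith
  rw [norm_norm, Real.norm_of_nonneg (hρ k).le]
  have h5 : D k + (k : ℝ)⁻¹ * ∑ l ∈ Finset.range k, D (l + 1) ≤ (b₁ + b₂) * ρ k := by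
    linarith [hD k, hDD k]
  have h6 := h.norm_sub_le hd₀ qStar k
  have h7 := mul_le_mul_of_nonneg_left h5 hK
  rw [← hDdef] at h6
  linarith [hε k]

end IsR1QLRun

end MDP

/-! ### Summability of the rates k^(-r) (log k)^s -/

section Rates

/-- Partial sums of a positive sequence are dominated by any positive sequence whose increments
eventually dominate a multiple of it. -/
lemma isBigO_sum_range_of_le_sub {ρ u : ℕ → ℝ} {b : ℝ} {N : ℕ} (hb : 0 < b) (hu : 0 < u N)
    (hρ : ∀ k, 0 ≤ ρ k) (h : ∀ k ≥ N, b * ρ k ≤ u (k + 1) - u k) :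
    (fun k => ∑ l ∈ Finset.range k, ρ l) =O[atTop] u := by
  set m := ∑ l ∈ Finset.range N, ρ l with hm
  have hm0 : 0 ≤ m := Finset.sum_nonneg fun l _ => hρ l
  have key : ∀ k ≥ N, u N ≤ u k ∧ b * ∑ l ∈ Finset.range k, ρ l ≤ b * m + (u k - u N) := by
    intro k hk
    induction k, hk using Nat.le_induction with
    | base => simp [hm]
    | succ k hk ih =>
      rw [Finset.sum_range_succ, mul_add]
      have h1 := h k hk
      have h2 := mul_nonneg hb.le (hρ k)
      exact ⟨by linarith [ih.1], by linarith [ih.2]⟩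
  refine IsBigO.of_bound (b⁻¹ * (b * m / u N + 1)) ?_
  filter_upwards [eventually_ge_atTop N] with k hk
  obtain ⟨h1, h2⟩ := key k hk
  rw [Real.norm_of_nonneg (Finset.sum_nonneg fun l _ => hρ l),
    Real.norm_of_nonneg (hu.le.trans h1), mul_assoc, ← div_eq_inv_mul, le_div_iff₀ hb]
  have h3 : b * m ≤ b * m / u N * u k := by
    rw [div_mul_eq_mul_div, le_div_iff₀ hu]
    exact mul_le_mul_of_nonneg_left h1 (by positivity)
  linarith

lemma rpow_mul_log_rpow_pos (r s : ℝ) {k : ℕ} (hk : 2 ≤ k) :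
    0 < (k : ℝ) ^ r * Real.log k ^ s := by
  have hk' : (1 : ℝ) < k := by exact_mod_cast hk
  exact mul_pos (Real.rpow_pos_of_pos (by linarith) _) (Real.rpow_pos_of_pos (Real.log_pos hk') _)

/-- Discrete form of (x^p log^s x)' ~ p x^(p-1) log^s x. Half of `p` is given up to the logarithmic
factor, another half to k + 1 ≤ 2k. -/
lemma exists_rpow_mul_log_rpow_increment {p : ℝ} (hp : 0 < p) (s : ℝ) :
    ∃ N : ℕ, 2 ≤ N ∧ ∀ k : ℕ, N ≤ k → p / 4 * ((k : ℝ) ^ (p - 1) * Real.log k ^ s) ≤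
      ((k + 1 : ℕ) : ℝ) ^ p * Real.log ((k + 1 : ℕ) : ℝ) ^ s - (k : ℝ) ^ p * Real.log k ^ s := by
  have hlog : Tendsto (fun k : ℕ => Real.log k) atTop atTop :=
    Real.tendsto_log_atTop.comp tendsto_natCast_atTop_atTop
  -- From here on |s| times the increment of log log is at most (p/2)δ, with δ the increment of log.
  obtain ⟨N, hN⟩ := eventually_atTop.1 (hlog.eventually_ge_atTop (2 * |s| / p))
  refine ⟨max N 2, le_max_right _ _, fun k hk => ?_⟩
  have hk2 : 2 ≤ k := (le_max_right _ _).trans hk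
  have hk1 : (2 : ℝ) ≤ k := by exact_mod_cast hk2
  have hL : 0 < Real.log k := Real.log_pos (by linarith)
  have hL' : 0 < Real.log ((k : ℝ) + 1) := Real.log_pos (by linarith)
  have hLN : |s| ≤ p / 2 * Real.log k := by
    have := hN k ((le_max_left _ _).trans hk)
    rw [div_le_iff₀ hp] at this
    linarith
  set δ := Real.log ((k : ℝ) + 1) - Real.log k with hδ
  have hδ1 : 1 / ((k : ℝ) + 1) ≤ δ := by
    have h1 := Real.one_sub_inv_le_log_of_pos (show 0 < ((k : ℝ) + 1) / k by positivity)
    rw [Real.log_div (by positivity) (by positivity)] at h1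
    have h2 : 1 - (((k : ℝ) + 1) / k)⁻¹ = 1 / ((k : ℝ) + 1) := by field_simp; ring
    linarith
  have hδ0 : 0 ≤ δ := le_trans (by positivity) hδ1
  have hLL : |Real.log (Real.log ((k : ℝ) + 1)) - Real.log (Real.log k)| ≤ δ / Real.log k := by
    rw [abs_of_nonneg (sub_nonneg.2 (Real.log_le_log hL (by linarith))),
      ← Real.log_div hL'.ne' hL.ne']
    refine (Real.log_le_sub_one_of_pos (div_pos hL' hL)).trans_eq ?_
    rw [hδ, sub_div, div_self hL.ne']
  have hexp : ∀ y : ℝ, 0 < y → 0 < Real.log y →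
      y ^ p * Real.log y ^ s = Real.exp (p * Real.log y + s * Real.log (Real.log y)) := by
    intro y hy hly
    rw [Real.rpow_def_of_pos hy, Real.rpow_def_of_pos hly, ← Real.exp_add]
    ring_nf
  set u := (k : ℝ) ^ p * Real.log k ^ s with hu
  have hu0 : 0 < u := rpow_mul_log_rpow_pos p s hk2
  have hratio : u * (1 + p / 2 * (1 / ((k : ℝ) + 1))) ≤
      ((k : ℝ) + 1) ^ p * Real.log ((k : ℝ) + 1) ^ s := by
    rw [hexp _ (by linarith) hL', show p * Real.log ((k : ℝ) + 1) +
      s * Real.log (Real.log ((k : ℝ) + 1)) =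
        (p * Real.log k + s * Real.log (Real.log k)) +
        (p * δ + s * (Real.log (Real.log ((k : ℝ) + 1)) - Real.log (Real.log k))) by rw [hδ]; ring,
      Real.exp_add, ← hexp _ (by linarith) hL]
    refine mul_le_mul_of_nonneg_left ?_ hu0.le
    have h1 : -(p / 2 * δ) ≤ s * (Real.log (Real.log ((k : ℝ) + 1)) - Real.log (Real.log k)) := by
      refine neg_le_of_abs_le ?_
      rw [abs_mul]
      calc _ ≤ p / 2 * Real.log k * (δ / Real.log k) :=
            mul_le_mul hLN hLL (abs_nonneg _) (by positivity)
        _ = p / 2 * δ := by field_simp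
    have h2 := mul_le_mul_of_nonneg_left hδ1 (half_pos hp).le
    linarith [Real.add_one_le_exp
      (p * δ + s * (Real.log (Real.log ((k : ℝ) + 1)) - Real.log (Real.log k)))]
  have hsub : (k : ℝ) ^ (p - 1) * Real.log k ^ s = u / k := by
    rw [Real.rpow_sub_one (by positivity), hu]; ring
  rw [hsub]
  push_cast
  have h3 : p / 4 * (u / k) ≤ u * (p / 2 * (1 / ((k : ℝ) + 1))) := by
    rw [show p / 4 * (u / k) = p * u / (4 * k) by field_simp,
      show u * (p / 2 * (1 / ((k : ℝ) + 1))) = p * u / (2 * (k + 1)) by field_simp]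
    exact div_le_div_of_nonneg_left (by positivity) (by positivity) (by linarith)
  linarith

lemma exists_pos_eventuallyEq_rpow_mul_log_rpow {r : ℝ} (hr : r < 1) (s : ℝ) :
    ∃ ρ : ℕ → ℝ, (∀ k, 0 < ρ k) ∧
      (fun k => ∑ l ∈ Finset.range k, ρ l) =O[atTop] (fun k => (k : ℝ) * ρ k) ∧
      ρ =ᶠ[atTop] fun k : ℕ => (k : ℝ) ^ (-r) * Real.log k ^ s := by
  -- The formula can vanish for k < 2, where log k = 0.
  set ρ : ℕ → ℝ := fun k => if 2 ≤ k then (k : ℝ) ^ (-r) * Real.log k ^ s else 1 with hρ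
  have hρ2 : ∀ k, 2 ≤ k → ρ k = (k : ℝ) ^ (-r) * Real.log k ^ s := fun k hk => if_pos hk
  have hρ0 : ∀ k, 0 < ρ k := fun k => by
    by_cases hk : 2 ≤ k
    · rw [hρ2 k hk]
      exact rpow_mul_log_rpow_pos _ _ hk
    · simp [hρ, hk]
  have heq : ρ =ᶠ[atTop] fun k : ℕ => (k : ℝ) ^ (-r) * Real.log k ^ s :=
    (eventually_ge_atTop 2).mono hρ2
  refine ⟨ρ, hρ0, ?_, heq⟩
  obtain ⟨N, hN2, hN⟩ := exists_rpow_mul_log_rpow_increment (sub_pos.2 hr) s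
  refine (isBigO_sum_range_of_le_sub (u := fun k : ℕ => (k : ℝ) ^ (1 - r) * Real.log k ^ s)
    (b := (1 - r) / 4) (N := N) (by linarith) (rpow_mul_log_rpow_pos _ _ hN2)
    (fun k => (hρ0 k).le) fun k hk => ?_).congr' EventuallyEq.rfl ?_
  · rw [hρ2 k (hN2.trans hk), ← sub_sub_cancel_left 1 r]
    exact hN k hk
  · filter_upwards [eventually_ge_atTop 2] with k hk
    rw [hρ2 k hk, sub_eq_add_neg, Real.rpow_add (by positivity), Real.rpow_one, mul_assoc]

end Rates

/-! ### Necessity of r < 1, and the law of large numbers -/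

namespace MDP

/-- The factor at `l = 0` is γ. For l ≥ 1, Bernoulli's inequality with exponent 1-γ bounds the
factor below by (l/(l+1))^(1-γ), and these telescope. -/
lemma mul_rpow_le_prod {γ : ℝ} (hγ₀ : 0 < γ) (hγ : γ < 1) {k : ℕ} (hk : 1 ≤ k) :
    γ * (k : ℝ) ^ (-(1 - γ)) ≤ ∏ l ∈ Finset.range k, (1 - (1 - γ) * stepSize l) := by
  induction k, hk using Nat.le_induction with
  | base => simp [stepSize]
  | succ k hk ih =>
    have hk' : (0 : ℝ) < k := by exact_mod_cast hk
    rw [Finset.prod_range_succ]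
    have h1 := rpow_one_add_le_one_add_mul_self (s := -stepSize k)
      (by linarith [stepSize_le_one k]) (p := 1 - γ) (by linarith) (by linarith)
    have h2 : 1 + -stepSize k = k / ((k : ℝ) + 1) := by
      rw [stepSize]; field_simp; ring
    rw [h2, Real.div_rpow hk'.le (by positivity)] at h1
    have h3 : (((k + 1 : ℕ) : ℝ)) ^ (-(1 - γ)) =
        (k : ℝ) ^ (-(1 - γ)) * ((k : ℝ) ^ (1 - γ) / ((k : ℝ) + 1) ^ (1 - γ)) := by
      push_cast
      rw [Real.rpow_neg hk'.le, Real.rpow_neg (by positivity)]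
      have := (Real.rpow_pos_of_pos hk' (1 - γ)).ne'
      field_simp
    rw [h3, ← mul_assoc]
    refine mul_le_mul ih (by linarith) (by positivity) (le_trans (by positivity) ih)

/-- The product decays no faster than k^(-(1-γ)), and 1-γ < 1, so no power of log can rescue r ≥ 1.
-/
lemma lt_one_of_prod_isBigO {γ : ℝ} (hγ₀ : 0 < γ) (hγ : γ < 1) {r s : ℝ}
    (h : (fun k : ℕ => ∏ l ∈ Finset.range k, (1 - (1 - γ) * stepSize l)) =O[atTop]
      fun k : ℕ => (k : ℝ) ^ (-r) * Real.log k ^ s) : r < 1 := by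
  by_contra! hr
  have h1 : (fun k : ℕ => (k : ℝ) ^ (-(1 - γ))) =O[atTop]
      fun k : ℕ => ∏ l ∈ Finset.range k, (1 - (1 - γ) * stepSize l) := by
    refine IsBigO.of_bound γ⁻¹ ?_
    filter_upwards [eventually_ge_atTop 1] with k hk
    rw [Real.norm_of_nonneg (by positivity), ← div_eq_inv_mul, le_div_iff₀ hγ₀, mul_comm]
    exact (mul_rpow_le_prod hγ₀ hγ hk).trans (le_abs_self _)
  have hlog : (fun k : ℕ => Real.log k ^ s) =o[atTop] fun k : ℕ => (k : ℝ) ^ (r - (1 - γ)) :=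
    (isLittleO_log_rpow_rpow_atTop s (by linarith)).comp_tendsto tendsto_natCast_atTop_atTop
  have h2 : (fun k : ℕ => (k : ℝ) ^ (-r) * Real.log k ^ s) =o[atTop]
      fun k : ℕ => (k : ℝ) ^ (-(1 - γ)) := by
    refine ((isBigO_refl (fun k : ℕ => (k : ℝ) ^ (-r)) atTop).mul_isLittleO hlog).congr'
      EventuallyEq.rfl ?_
    filter_upwards [eventually_ge_atTop 1] with k hk
    rw [← Real.rpow_add (by positivity)]
    ring_nf
  have h3 := (h1.trans h).trans_isLittleO h2
  refine isLittleO_irrefl ?_ h3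
  refine ((eventually_ge_atTop 1).mono fun k hk => ?_).frequently
  positivity

variable {S A Ω : Type*} [Fintype S] [MeasurableSpace S] [MeasurableSingletonClass S]

open Classical in
/-- The empirical frequencies of the sampled next states converge almost surely. -/
lemma IsSampling.ae_tendsto_frequency [Finite A] {M : MDP S A} [MeasurableSpace Ω] {μ : Measure Ω}
    [IsProbabilityMeasure μ] {X : ℕ → S × A → Ω → S} (hX : M.IsSampling μ X) :
    ∀ᵐ ω ∂μ, ∀ z s', Tendsto (fun k : ℕ => (k : ℝ)⁻¹ * ∑ l ∈ Finset.range k,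
      ((if X l z ω = s' then 1 else 0) - (M.P z.1 z.2 s').toReal)) atTop (𝓝 0) := by
  rw [ae_all_iff]
  intro z
  rw [ae_all_iff]
  intro s'
  set g : S → ℝ := fun s => if s = s' then 1 else 0 with hg
  have hgm : Measurable g := measurable_of_finite g
  have hbdd : ∀ s, ‖g s‖ ≤ 1 := fun s => by
    by_cases h : s = s' <;> simp [hg, h]
  have hmean : ∫ ω, g (X 0 z ω) ∂μ = (M.P z.1 z.2 s').toReal := by
    rw [← integral_map (hX.measurable 0 z).aemeasurable hgm.aestronglyMeasurable, hX.law,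
      PMF.integral_eq_sum]
    simp [hg]
  -- The pair `z` is fixed, so only independence across iterations enters.
  have hlaw := strong_law_ae_real (μ := μ) (fun l ω => g (X l z ω))
    (Integrable.of_bound (hgm.comp (hX.measurable 0 z)).aestronglyMeasurable 1
      (Eventually.of_forall fun ω => hbdd _))
    (fun i j hij => (hX.indep.indepFun hij).comp (φ := fun f : S × A → S => g (f z))
      (ψ := fun f : S × A → S => g (f z)) (hgm.comp (measurable_pi_apply z))
      (hgm.comp (measurable_pi_apply z)))
    (fun l => IdentDistrib.comp ⟨(hX.measurable l z).aemeasurable,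
      (hX.measurable 0 z).aemeasurable, by rw [hX.law, hX.law]⟩ hgm)
  filter_upwards [hlaw] with ω hω
  rw [hmean] at hω
  have := hω.sub_const (M.P z.1 z.2 s').toReal
  rw [sub_self] at this
  refine this.congr' ?_
  filter_upwards [eventually_gt_atTop 0] with k hk
  have hk' : (k : ℝ) ≠ 0 := by positivity
  rw [Finset.sum_sub_distrib, Finset.sum_const, Finset.card_range, nsmul_eq_mul, mul_sub,
    inv_mul_cancel_left₀ hk', div_eq_inv_mul]

end MDP

/-! ### The main theorem -/

theorem theorem2 {S A Ω : Type*} [Fintype S] [MeasurableSpace S] [MeasurableSingletonClass S]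
    [Fintype A] [Nonempty A] (M : MDP S A)
    [MeasurableSpace Ω] (μ : Measure Ω) [IsProbabilityMeasure μ]
    (X : ℕ → S × A → Ω → S) (hX : M.IsSampling μ X) :
    ∃ qStar : S × A → ℝ, M.IsOptimalQ qStar ∧ qStar = M.bellmanQ qStar ∧
      -- almost sure convergence, and comparison of rates along each run
      (∀ q₀ d₀ : S × A → ℝ, d₀ ∈ stdSimplex ℝ (S × A) →
        ∀ (q d : Ω → ℕ → S × A → ℝ) (a : Ω → ℕ → S × A → A),
        (∀ ω, M.IsR1QLRun (fun k z => X k z ω) q₀ d₀ (q ω) (d ω) (a ω)) →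
        ∀ᵐ ω ∂μ, Tendsto (q ω) atTop (𝓝 qStar) ∧
          ∀ ρ : ℕ → ℝ, (∀ k, 0 < ρ k) →
            (fun k => ∑ l ∈ Finset.range k, ρ l) =O[atTop] (fun k => (k : ℝ) * ρ k) →
            (fun k => ‖M.qlIter (fun k z => X k z ω) q₀ k - qStar‖) =O[atTop] ρ →
            (fun k => ‖q ω k - qStar‖) =O[atTop] ρ) ∧
      -- comparison of rates valid for all initializations
      (∀ r s : ℝ,
        (∀ q₀ : S × A → ℝ, ∀ᵐ ω ∂μ,
          (fun k => ‖M.qlIter (fun k z => X k z ω) q₀ k - qStar‖) =O[atTop]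
            (fun k : ℕ => (k : ℝ) ^ (-r) * Real.log k ^ s)) →
        ∀ q₀ d₀ : S × A → ℝ, d₀ ∈ stdSimplex ℝ (S × A) →
          ∀ (q d : Ω → ℕ → S × A → ℝ) (a : Ω → ℕ → S × A → A),
          (∀ ω, M.IsR1QLRun (fun k z => X k z ω) q₀ d₀ (q ω) (d ω) (a ω)) →
          ∀ᵐ ω ∂μ, (fun k => ‖q ω k - qStar‖) =O[atTop]
            (fun k : ℕ => (k : ℝ) ^ (-r) * Real.log k ^ s)) := by
  obtain ⟨qStar, hq⟩ := M.exists_bellmanQ_fixedPoint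
  refine ⟨qStar, M.isOptimalQ_of_eq_bellmanQ hq, hq, ?_, ?_⟩
  · intro q₀ d₀ hd₀ q d a hrun
    -- This event does not depend on `ρ`, so one null set serves all rates.
    filter_upwards [hX.ae_tendsto_frequency] with ω hω
    exact ⟨(hrun ω).tendsto_of_tendsto_qlIter hd₀ (M.tendsto_norm_qlIter_sub _ q₀ qStar hq hω),
      fun ρ hρ hsum hql => (hrun ω).isBigO_of_isBigO_qlIter hd₀ hρ hsum hql⟩
  · intro r s hql q₀ d₀ hd₀ q d a hrun
    obtain ⟨z⟩ : Nonempty (S × A) := by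
      by_contra hne
      rw [not_nonempty_iff] at hne
      simpa using hd₀.2
    -- On a common path, the runs from `q₀` and `q₀ + 1` differ by exactly the product, which
    -- therefore inherits the assumed rate.
    have hr : r < 1 := by
      obtain ⟨ω, h0, h1⟩ := ((hql q₀).and (hql fun y => q₀ y + 1)).exists
      refine MDP.lt_one_of_prod_isBigO M.γ_pos M.γ_lt_one
        (IsBigO.trans (IsBigO.of_norm_le fun k => ?_) (h1.add h0))
      have hk := M.qlIter_add_const (fun k z => X k z ω) q₀ 1 k z
      rw [one_mul] at hk
      rw [← sub_eq_iff_eq_add'.2 hk, ← sub_sub_sub_cancel_right _ _ (qStar z)]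
      exact (norm_sub_le _ _).trans (add_le_add
        (norm_le_pi_norm (M.qlIter (fun k z => X k z ω) (fun y => q₀ y + 1) k - qStar) z)
        (norm_le_pi_norm (M.qlIter (fun k z => X k z ω) q₀ k - qStar) z))
    obtain ⟨ρ, hρ, hsum, heq⟩ := exists_pos_eventuallyEq_rpow_mul_log_rpow hr s
    filter_upwards [hql q₀] with ω hω
    exact ((hrun ω).isBigO_of_isBigO_qlIter hd₀ hρ hsum
      (hω.congr' EventuallyEq.rfl heq.symm)).congr' EventuallyEq.rfl heq
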